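/- All graphs are finite, simple and undirected; a graph is nontrivial if it has at least two vertices, and $\delta$ denotes the minimum degree. For graphs $G$ and $H$, the exponential graph $G^H$ has as vertices the pairs $(f;w)$ with $f:V(H)\to V(G)$ and $w\in V(H)$. Two vertices $(f;w)$ and $(g;z)$ are adjacent if and only if either $w=z$, $f(w)g(w)\in E(G)$ and $f(i)=g(i)$ for all $i\neq w$, or $wz\in E(H)$ and $f=g$. An edge-cut of a connected graph is a set of its edges whose deletion leaves a disconnected graph; a minimum edge-cut is one of minimum cardinality. An edge-cut $F$ of a graph $X$ isolates a vertex if $F$ is the set of all edges incident with some vertex $u$ with $\deg_X(u)=\delta(X)$. A connected graph is super edge-connected if each of its minimum edge-cuts isolates a vertex. **Theorem.** Let $G$ and $H$ be nontrivial connected graphs. Then $G^H$ is super edge-connected if and only if both (i) $\delta(G)\ge 2$ or $H$ is not a complete graph, and (ii) $\delta(H)\ge 2$ or $G$ is not a complete graph. Moreover, in the remaining cases there are the following minimum edge-cuts that isolate no vertex. - If $H$ is complete and $a\in V(G)$ has degree $1$ with neighbour $b$, let $\mathbf a:V(H)\to V(G)$ be the constant map with value $a$, and for $w\in V(H)$ let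 $\mathbf a_w$ be the map that takes the value $b$ at $w$ and $a$ elsewhere. Then $$F_1=\{(\mathbf a;w)(\mathbf a_w;w) \mid w\in V(H)\}$$ is a minimum edge-cut of $G^H$ that does not isolate a vertex. - If $G$ is complete, $c\in V(H)$ has degree $1$ with neighbour $d$, and $f:V(H)\to V(G)$ is any map, write $f_t$ for the map that takes the value $t$ at $c$ and agrees with $f$ elsewhere. Then $$F_2=\{(f_t;c)(f_t;d) \mid t\in V(G)\}$$ is a minimum edge-cut of $G^H$ that does not isolate a vertex. -/

import Mathlib

namespace SimpleGraph

universe u v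

/-- The exponential graph `G ^ H` with base `G` and exponent `H`. A vertex `(f, w)` consists of
a tuple `f` of vertices of `G` indexed by the vertices of `H`, and a vertex `w` of `H`.
A `G`-edge of dimension `w` moves the coordinate `f w` along an edge of `G`, fixing the other
coordinates and `w`; an `H`-edge moves `w` along an edge of `H`, fixing `f`. -/
def expGraph {V : Type u} {W : Type v} (G : SimpleGraph V) (H : SimpleGraph W) :
    SimpleGraph ((W → V) × W) where
  Adj x y :=
    (x.2 = y.2 ∧ G.Adj (x.1 x.2) (y.1 x.2) ∧ ∀ i, i ≠ x.2 → x.1 i = y.1 i) ∨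
      (H.Adj x.2 y.2 ∧ ∀ i, x.1 i = y.1 i)
  symm := ⟨by
    rintro ⟨f, j⟩ ⟨g, k⟩ (⟨h1, h2, h3⟩ | ⟨h1, h2⟩)
    · dsimp only at h1 h2 h3
      subst h1
      exact Or.inl ⟨rfl, h2.symm, fun i hi => (h3 i hi).symm⟩
    · exact Or.inr ⟨h1.symm, fun i => (h2 i).symm⟩⟩
  loopless := ⟨by
    rintro ⟨f, j⟩ (⟨_, h, _⟩ | ⟨h, _⟩)
    · exact G.irrefl h
    · exact H.irrefl h⟩

instance expGraph.decidableAdj {V : Type u} {W : Type v} [DecidableEq V] [Fintype W]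
    [DecidableEq W] (G : SimpleGraph V) (H : SimpleGraph W) [DecidableRel G.Adj]
    [DecidableRel H.Adj] : DecidableRel (expGraph G H).Adj := fun x y =>
  inferInstanceAs (Decidable
    ((x.2 = y.2 ∧ G.Adj (x.1 x.2) (y.1 x.2) ∧ ∀ i, i ≠ x.2 → x.1 i = y.1 i) ∨
      (H.Adj x.2 y.2 ∧ ∀ i, x.1 i = y.1 i)))

/-- `F` is an edge-cut of `G`: a set of edges of `G` whose deletion disconnects `G`. -/
def IsEdgeCut {V : Type u} (G : SimpleGraph V) (F : Set (Sym2 V)) : Prop :=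
  F ⊆ G.edgeSet ∧ ¬ (G.deleteEdges F).Connected

/-- `F` is an edge-cut of `G` of minimum cardinality. -/
def IsMinEdgeCut {V : Type u} [Fintype V] (G : SimpleGraph V) (F : Set (Sym2 V)) : Prop :=
  IsEdgeCut G F ∧ ∀ F' : Set (Sym2 V), IsEdgeCut G F' → F.ncard ≤ F'.ncard

/-- `F` isolates a vertex of `G`: it is the set of all edges incident with some vertex of
minimum degree. -/
def IsolatesVertex {V : Type u} [Fintype V] (G : SimpleGraph V) [DecidableRel G.Adj]
    (F : Set (Sym2 V)) : Prop :=
  ∃ x : V, G.degree x = G.minDegree ∧ F = G.incidenceSet x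

/-- `G` is super edge-connected: it is connected and every minimum edge-cut isolates a vertex. -/
def IsSuperEdgeConnected {V : Type u} [Fintype V] (G : SimpleGraph V) [DecidableRel G.Adj] :
    Prop :=
  G.Connected ∧ ∀ F : Set (Sym2 V), IsMinEdgeCut G F → IsolatesVertex G F

/-- For an edge `ab` of the base: the `G`-edges joining `((a, …, a), w)` to
`((a, …, b, …, a), w)`, with `b` in position `w`, for all vertices `w` of the exponent. -/
def baseCut {V : Type u} (W : Type v) [DecidableEq W] (a b : V) : Set (Sym2 ((W → V) × W)) :=
  Set.range fun w : W => s((fun _ => a, w), (Function.update (fun _ => a) w b, w))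

/-- For an edge `cd` of the exponent and a tuple `f`: the `H`-edges joining `(g, c)` to `(g, d)`,
for all `g` that agree with `f` outside position `c`. -/
def exponentCut {V : Type u} {W : Type v} [DecidableEq W] (f : W → V) (c d : W) :
    Set (Sym2 ((W → V) × W)) :=
  Set.range fun t : V => s((Function.update f c t, c), (Function.update f c t, d))

end SimpleGraph

/-! Call `w` the position of a vertex `(f, w)`; a `G`-edge changes only the coordinate at the
position. Hence degrees add, and δ(G^H) = δ(G) + δ(H). Every edge-cut contains the boundary of some
vertex set `T`, so everything rests on `cut_bound`: a boundary has at least δ(G) + δ(H) edges, and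
under (i) and (ii) equality forces `T` or its complement to be a single vertex.

Boundaries are bounded by packing: subgraphs that pairwise share at most one vertex have disjoint
edge sets, so their boundaries add up. The pieces are copies of `H` (fixed tuple), lines (copies of
`G`, one coordinate moving) and slices (one coordinate fixed).

If `T` contains a slice and its complement a parallel one, many lines cross. Otherwise, up to
complement, `T` contains no slice. If `T` lies in one copy of `H`, that copy and the lines through
`T` suffice. If members of `T` differ at `w` and some member has position `w`, its line and at least
two slices suffice, each slice giving δ(H) by `slab_bound`. If no member has position `w`, `T`
splits by its values at `w` into parts with no edges between them, and induction applies. In the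
exceptional cases a whole copy of `H` or of `G` also attains the bound. -/

namespace SimpleGraph

/-! ### Edge boundaries and minimum degree in an arbitrary graph. -/

section CutPairs

variable {α β : Type*} [Fintype α] [Fintype β]

open Classical in
/-- The ordered pairs `(x, y)` of adjacent vertices in `P` with `x ∈ T` and `y ∉ T`: the edge
boundary of `T` in the subgraph of `K` induced on `P`. -/
noncomputable def cutPairs (K : SimpleGraph α) (P T : Set α) : Finset (α × α) :=
  {e | (e.1 ∈ P ∧ e.2 ∈ P) ∧ e.1 ∈ T ∧ e.2 ∉ T ∧ K.Adj e.1 e.2}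

theorem mem_cutPairs {K : SimpleGraph α} {P T : Set α} {e : α × α} :
    e ∈ K.cutPairs P T ↔ (e.1 ∈ P ∧ e.2 ∈ P) ∧ e.1 ∈ T ∧ e.2 ∉ T ∧ K.Adj e.1 e.2 := by
  simp [cutPairs]

/-- The packing principle: an edge lying in two pieces would give them two common vertices. -/
theorem sum_card_cutPairs_le {ι : Type*} (K : SimpleGraph α) (s : Finset ι) (P : ι → Set α)
    (Q T : Set α) (hQ : ∀ i ∈ s, P i ⊆ Q)
    (hP : ∀ i ∈ s, ∀ j ∈ s, i ≠ j → (P i ∩ P j).Subsingleton) :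
    ∑ i ∈ s, (K.cutPairs (P i) T).card ≤ (K.cutPairs Q T).card := by
  classical
  rw [← Finset.card_biUnion]
  · refine Finset.card_le_card fun e he => ?_
    obtain ⟨i, hi, he⟩ := Finset.mem_biUnion.1 he
    rw [mem_cutPairs] at he ⊢
    exact ⟨⟨hQ i hi he.1.1, hQ i hi he.1.2⟩, he.2⟩
  · intro i hi j hj hij
    refine Finset.disjoint_left.2 fun e he he' => ?_
    rw [mem_cutPairs] at he he'
    exact he.2.2.2.ne (hP i hi j hj hij ⟨he.1.1, he'.1.1⟩ ⟨he.1.2, he'.1.2⟩)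

theorem card_cutPairs_compl (K : SimpleGraph α) (P T : Set α) :
    (K.cutPairs P Tᶜ).card = (K.cutPairs P T).card := by
  refine Finset.card_bij' (fun e _ => e.swap) (fun e _ => e.swap) ?_ ?_ ?_ ?_ <;>
    simp +contextual [mem_cutPairs, K.adj_comm]

theorem card_cutPairs_comp_le {K' : SimpleGraph β} {K : SimpleGraph α} (φ : β → α)
    (hφ : Function.Injective φ) (hadj : ∀ x y, K'.Adj x y → K.Adj (φ x) (φ y)) {P : Set α}
    (hP : ∀ x, φ x ∈ P) (T : Set α) :
    (K'.cutPairs Set.univ (φ ⁻¹' T)).card ≤ (K.cutPairs P T).card := by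
  refine Finset.card_le_card_of_injOn (Prod.map φ φ) ?_ (hφ.prodMap hφ).injOn
  intro e he
  simp only [Finset.mem_coe, mem_cutPairs] at he ⊢
  exact ⟨⟨hP _, hP _⟩, he.2.1, he.2.2.1, hadj _ _ he.2.2.2⟩

theorem Connected.one_le_card_cutPairs {K : SimpleGraph α} (hK : K.Connected) {T : Set α}
    {x y : α} (hx : x ∈ T) (hy : y ∉ T) : 1 ≤ (K.cutPairs Set.univ T).card := by
  obtain ⟨p⟩ := hK.preconnected x y
  obtain ⟨d, -, h1, h2⟩ := p.exists_boundary_dart T hx hy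
  exact Finset.card_pos.2 ⟨(d.fst, d.snd), by simp [mem_cutPairs, h1, h2, d.adj]⟩

theorem minDegree_add_one_le_add_card_cutPairs {K : SimpleGraph α} [DecidableRel K.Adj]
    {T : Set α} {x : α} (hx : x ∈ T) :
    K.minDegree + 1 ≤ T.ncard + ({y | y ∉ T ∧ K.Adj x y} : Set α).ncard := by
  have h1 : K.minDegree ≤ (K.neighborSet x).ncard := by
    rw [Set.ncard_eq_toFinset_card', ← neighborFinset_def]
    exact K.minDegree_le_degree x
  have h2 : K.neighborSet x ⊆ (T \ {x}) ∪ {y | y ∉ T ∧ K.Adj x y} := by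
    intro y hy
    by_cases hT : y ∈ T
    · exact Or.inl ⟨hT, fun h => K.ne_of_adj hy h.symm⟩
    · exact Or.inr ⟨hT, hy⟩
  have h3 := (Set.ncard_le_ncard h2 (Set.toFinite _)).trans (Set.ncard_union_le _ _)
  have h4 := Set.ncard_sdiff_singleton_add_one hx (Set.toFinite T)
  omega

/-- A vertex of `T` has at most `|T| - 1` neighbours inside `T`, so the rest of its neighbours lie
outside. -/
theorem ncard_mul_le_card_cutPairs (K : SimpleGraph α) [DecidableRel K.Adj] (T : Set α) :
    T.ncard * (K.minDegree + 1 - T.ncard) ≤ (K.cutPairs Set.univ T).card := by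
  classical
  have h : (K.cutPairs Set.univ T).card =
      ∑ x ∈ T.toFinset, ({y | y ∉ T ∧ K.Adj x y} : Set α).ncard := by
    rw [Finset.card_eq_sum_card_fiberwise (f := Prod.fst) (t := T.toFinset)]
    · refine Finset.sum_congr rfl fun x hx => ?_
      rw [← Set.ncard_coe_finset]
      refine (Set.ncard_congr (fun y _ => (x, y)) ?_ ?_ ?_).symm
      · intro y hy
        simp_all [mem_cutPairs]
      · intro y z _ _ h
        exact (Prod.ext_iff.1 h).2
      · rintro ⟨p, q⟩ hpq
        simp only [Finset.coe_filter, mem_cutPairs, Set.mem_ofPred_eq] at hpq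
        obtain ⟨h, rfl⟩ := hpq
        exact ⟨q, h.2.2, rfl⟩
    · intro e he
      simp only [Finset.mem_coe, mem_cutPairs] at he
      simpa using he.2.1
  rw [h, Set.ncard_eq_toFinset_card', ← smul_eq_mul]
  refine Finset.card_nsmul_le_sum _ _ _ fun x hx => ?_
  have := K.minDegree_add_one_le_add_card_cutPairs (T := T) (x := x) (by simpa using hx)
  rw [Set.ncard_eq_toFinset_card' T] at this
  omega

theorem minDegree_le_card_cutPairs (K : SimpleGraph α) [DecidableRel K.Adj] {T : Set α}
    (h0 : T.Nonempty) (hT : T.ncard ≤ K.minDegree) :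
    K.minDegree ≤ (K.cutPairs Set.univ T).card := by
  refine le_trans ?_ (K.ncard_mul_le_card_cutPairs T)
  have h1 := (Set.ncard_pos (Set.toFinite T)).2 h0
  -- With `|T| = k + 1` and `δ = |T| + c`, the product `(k + 1)(c + 1)` exceeds `δ` by exactly `k *
  -- c`.
  obtain ⟨c, hc⟩ := Nat.exists_eq_add_of_le hT
  obtain ⟨k, hk⟩ := Nat.exists_eq_add_of_le h1
  rw [show K.minDegree + 1 - T.ncard = c + 1 by omega, hc, hk]
  nlinarith [Nat.zero_le (k * c)]

theorem eq_top_of_card_le_minDegree_add_one (K : SimpleGraph α) [DecidableRel K.Adj]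
    (h : Fintype.card α ≤ K.minDegree + 1) : K = ⊤ := by
  classical
  ext x y
  refine ⟨fun h => h.ne, fun hxy => ?_⟩
  have h1 : K.neighborFinset x ⊆ Finset.univ.erase x := fun z hz => by
    simpa using (K.ne_of_adj ((K.mem_neighborFinset x z).1 hz)).symm
  have h2 := Finset.eq_of_subset_of_card_le h1 (by
    rw [Finset.card_erase_of_mem (Finset.mem_univ _), Finset.card_univ, card_neighborFinset_eq_degree]
    have := K.minDegree_le_degree x
    omega)
  rw [← mem_neighborFinset, h2]
  simpa using (Ne.symm hxy)

theorem card_le_minDegree_add_one [Nonempty α] (K : SimpleGraph α) [DecidableRel K.Adj]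
    (hK : K = ⊤) : Fintype.card α ≤ K.minDegree + 1 := by
  classical
  obtain ⟨x, hx⟩ := K.exists_minimal_degree_vertex
  have h : Finset.univ.erase x ⊆ K.neighborFinset x := fun y hy => by
    rw [mem_neighborFinset, hK]
    exact (Finset.ne_of_mem_erase hy).symm
  have h1 := Finset.card_le_card h
  rw [Finset.card_erase_of_mem (Finset.mem_univ x), Finset.card_univ,
    card_neighborFinset_eq_degree, ← hx] at h1
  omega

theorem exists_adj_of_minDegree_lt_two [Nontrivial α] {G : SimpleGraph α} [DecidableRel G.Adj]
    (hG : G.Connected) (h : ¬ 2 ≤ G.minDegree) :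
    ∃ a b, G.degree a = 1 ∧ G.Adj a b := by
  obtain ⟨a, ha⟩ := G.exists_minimal_degree_vertex
  have := hG.preconnected.minDegree_pos_of_nontrivial
  have h1 : G.degree a = 1 := by omega
  obtain ⟨b, hb, -⟩ := G.degree_eq_one_iff_existsUnique_adj.1 h1
  exact ⟨a, b, h1, hb⟩

end CutPairs

/-! ### Slabs, lines and copies of the exponent. -/

section ExpGraph

variable {V W : Type*}

/-- The vertices of the exponential graph whose tuple agrees with `f` outside `U`. -/
def slab (U : Finset W) (f : W → V) : Set ((W → V) × W) :=
  {x | ∀ j, j ∉ U → x.1 j = f j}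

theorem mem_slab {U : Finset W} {f : W → V} {x : (W → V) × W} :
    x ∈ slab U f ↔ ∀ j, j ∉ U → x.1 j = f j := Iff.rfl

theorem expGraph_adj_prodMk {G : SimpleGraph V} {H : SimpleGraph W} (f : W → V)
    (i j : W) (h : H.Adj i j) : (expGraph G H).Adj (f, i) (f, j) :=
  Or.inr ⟨h, fun _ => rfl⟩

theorem slab_univ [Fintype W] (f : W → V) : slab Finset.univ f = Set.univ :=
  Set.eq_univ_of_forall fun _ j hj => absurd (Finset.mem_univ j) hj

variable [DecidableEq W]

theorem mem_slab_erase {U : Finset W} {f : W → V} {i : W} (hi : i ∈ U) {b : V}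
    {x : (W → V) × W} :
    x ∈ slab (U.erase i) (Function.update f i b) ↔ x ∈ slab U f ∧ x.1 i = b := by
  simp only [mem_slab]
  constructor
  · intro h
    refine ⟨fun j hj => ?_, by simpa using h i (by simp)⟩
    have hji : j ≠ i := fun h => hj (h ▸ hi)
    simpa [hji] using h j (by simp [hj])
  · rintro ⟨h, rfl⟩ j hj
    by_cases hji : j = i
    · subst hji; simp
    · simpa [hji] using h j (by simpa [hji] using hj)

/-- The copy of the base graph through `(f, i)`. -/
def baseLine (f : W → V) (i : W) (t : V) : (W → V) × W := (Function.update f i t, i)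

theorem baseLine_injective (f : W → V) (i : W) : Function.Injective (baseLine f i) := by
  intro s t h
  exact Function.update_injective f i (Prod.ext_iff.1 h).1

theorem expGraph_adj_baseLine {G : SimpleGraph V} {H : SimpleGraph W} (f : W → V) (i : W)
    (s t : V) (h : G.Adj s t) : (expGraph G H).Adj (baseLine f i s) (baseLine f i t) :=
  Or.inl ⟨rfl, by simpa [baseLine] using h, fun j hj => by simp_all [baseLine]⟩

variable [Fintype W]

theorem mem_slab_univ_erase {f : W → V} {i : W} {x : (W → V) × W} :
    x ∈ slab (Finset.univ.erase i) f ↔ x.1 i = f i := by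
  simp [mem_slab]

variable [Fintype V]

variable {G : SimpleGraph V} {H : SimpleGraph W}

/-- Each line in direction `i` inside the slab runs from one slice to the other, so it crosses the
boundary. These lines are disjoint. -/
theorem card_pow_le_card_cutPairs (hG : G.Connected) {U : Finset W} {f : W → V} {i : W}
    (hi : i ∈ U) {b c : V} {T : Set ((W → V) × W)}
    (hb : slab (U.erase i) (Function.update f i b) ⊆ T)
    (hc : slab (U.erase i) (Function.update f i c) ⊆ Tᶜ) :
    Fintype.card V ^ (U.card - 1) ≤ ((expGraph G H).cutPairs (slab U f) T).card := by
  -- One representative per line: coordinate `i` is pinned to `f i`.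
  set s : Finset (W → V) :=
    Fintype.piFinset (fun j => if j ∈ U.erase i then Finset.univ else {f j}) with hs
  have hmem : ∀ g, g ∈ s ↔ ∀ j, j ∉ U.erase i → g j = f j := by
    intro g
    rw [hs, Fintype.mem_piFinset]
    refine forall_congr' fun j => ?_
    by_cases hj : j ∈ U.erase i <;> simp only [hj] <;> simp
  have hcard : s.card = Fintype.card V ^ (U.card - 1) := by
    have h : ∀ j, (if j ∈ U.erase i then (Finset.univ : Finset V) else {f j}).card =
        if j ∈ U.erase i then Fintype.card V else 1 := fun j => by split_ifs <;> simp
    rw [hs, Fintype.card_piFinset, Finset.prod_congr rfl fun j _ => h j, Finset.prod_ite_mem,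
      Finset.univ_inter, Finset.prod_const, Finset.card_erase_of_mem hi]
  have hslab : ∀ g ∈ s, ∀ t, baseLine g i t ∈ slab (U.erase i) (Function.update f i t) := by
    intro g hg t j hj
    by_cases hji : j = i
    · subst hji; simp [baseLine]
    · simpa [baseLine, hji] using (hmem g).1 hg j hj
  have key := sum_card_cutPairs_le (expGraph G H) s (fun g => Set.range (baseLine g i))
    (slab U f) T ?_ ?_
  · refine le_trans ?_ key
    rw [← hcard, Finset.card_eq_sum_ones]
    refine Finset.sum_le_sum fun g hg => ?_
    refine le_trans ?_ (card_cutPairs_comp_le (K' := G) (baseLine g i) (baseLine_injective g i)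
      (expGraph_adj_baseLine g i) (fun t => Set.mem_range_self t) T)
    exact hG.one_le_card_cutPairs (x := b) (y := c) (hb (hslab g hg b)) (hc (hslab g hg c))
  · rintro g hg _ ⟨t, rfl⟩
    exact ((mem_slab_erase hi).1 (hslab g hg t)).1
  · rintro g hg g' hg' hne _ ⟨⟨t, rfl⟩, ⟨t', h⟩⟩
    refine absurd (funext fun j => ?_) hne
    by_cases hji : j = i
    · rw [(hmem g).1 hg j (by simp [hji]), (hmem g').1 hg' j (by simp [hji])]
    · simpa [baseLine, hji] using (congrFun (Prod.ext_iff.1 h).1 j).symm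

/-- Pack the copy of `H` (index `none`) with the lines at those positions of `T` that lie in `U`;
each such line meets `T` in one point only. -/
theorem card_cutPairs_of_subset_copy [DecidableRel G.Adj] (hpos : 1 ≤ G.minDegree)
    {U : Finset W} {f : W → V} {T : Set ((W → V) × W)}
    (hT : ∀ x ∈ T, x ∈ slab U f → x.1 = f) :
    (H.cutPairs Set.univ {i | (f, i) ∈ T}).card +
      ({i | (f, i) ∈ T} ∩ (U : Set W)).ncard * G.minDegree ≤
      ((expGraph G H).cutPairs (slab U f) T).card := by
  classical
  set A : Set W := {i | (f, i) ∈ T} with hA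
  let P : Option W → Set ((W → V) × W) := fun o =>
    o.elim (Set.range (Prod.mk f)) (fun i => Set.range (baseLine f i))
  have key := sum_card_cutPairs_le (expGraph G H) (Finset.insertNone (A ∩ U).toFinset) P
    (slab U f) T ?_ ?_
  · rw [Finset.sum_insertNone] at key
    refine le_trans (add_le_add ?_ ?_) key
    · exact card_cutPairs_comp_le (Prod.mk f) (Prod.mk_right_injective f)
        (expGraph_adj_prodMk f) (fun t => Set.mem_range_self t) T
    · rw [Set.ncard_eq_toFinset_card', ← smul_eq_mul]
      refine Finset.card_nsmul_le_sum _ _ _ fun i hi => ?_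
      rw [Set.mem_toFinset] at hi
      refine le_trans ?_ (card_cutPairs_comp_le (K' := G) (baseLine f i)
        (baseLine_injective f i) (expGraph_adj_baseLine f i) (fun t => Set.mem_range_self t) T)
      have h1 : baseLine f i ⁻¹' T = {f i} := by
        ext t
        simp only [Set.mem_preimage, Set.mem_singleton_iff]
        constructor
        · intro h
          have := hT _ h (fun j hj => by
            have : j ≠ i := fun h => hj (h ▸ hi.2)
            simp [baseLine, this])
          simpa [baseLine] using congrFun this i
        · rintro rfl
          simpa [baseLine] using show (f, i) ∈ T from hi.1
      exact G.minDegree_le_card_cutPairs (by simp [h1]) (by simpa [h1] using hpos)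
  · rintro (_ | i) hi
    · rintro _ ⟨j, rfl⟩
      exact fun _ _ => rfl
    · rintro _ ⟨t, rfl⟩ j hj
      have hiU : i ∈ U := by simpa using (Set.mem_toFinset.1 (Finset.some_mem_insertNone.1 hi)).2
      have : j ≠ i := fun h => hj (h ▸ hiU)
      simp [baseLine, this]
  · rintro (_ | i) - (_ | j) - hne
    · exact absurd rfl hne
    · rintro _ ⟨⟨k, rfl⟩, ⟨t, h⟩⟩ _ ⟨⟨k', rfl⟩, ⟨t', h'⟩⟩
      exact Prod.ext rfl ((Prod.ext_iff.1 h).2.symm.trans (Prod.ext_iff.1 h').2)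
    · rintro _ ⟨⟨t, h⟩, ⟨k, rfl⟩⟩ _ ⟨⟨t', h'⟩, ⟨k', rfl⟩⟩
      exact Prod.ext rfl ((Prod.ext_iff.1 h).2.symm.trans (Prod.ext_iff.1 h').2)
    · rintro _ ⟨⟨t, rfl⟩, ⟨t', h⟩⟩
      exact absurd (congrArg some (Prod.ext_iff.1 h).2.symm) hne

end ExpGraph

/-! ### Boundaries inside a slab. -/

section SlabBound

variable {V W : Type*} [Fintype V] [Fintype W] [DecidableEq W] [Nontrivial V]
  {G : SimpleGraph V} {H : SimpleGraph W} [DecidableRel H.Adj]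

theorem slab_bound_of_no_slice_subset (hG : G.Connected) (hH : H.Connected) {U : Finset W}
    (ih : ∀ i ∈ U, ∀ (f : W → V) (T : Set ((W → V) × W)),
      (∃ x ∈ slab (U.erase i) f, x ∈ T) → (∃ y ∈ slab (U.erase i) f, y ∉ T) →
      1 ≤ ((expGraph G H).cutPairs (slab (U.erase i) f) T).card ∧
        H.minDegree + 1 + (U.erase i).card ≤
          ((expGraph G H).cutPairs (slab (U.erase i) f) T).card + Fintype.card W)
    {f : W → V} {T : Set ((W → V) × W)} (hx : ∃ x ∈ slab U f, x ∈ T)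
    (hy : ∃ y ∈ slab U f, y ∉ T)
    (hno : ∀ i ∈ U, ∀ b, ¬ slab (U.erase i) (Function.update f i b) ⊆ T) :
    1 ≤ ((expGraph G H).cutPairs (slab U f) T).card ∧
      H.minDegree + 1 + U.card ≤
        ((expGraph G H).cutPairs (slab U f) T).card + Fintype.card W := by
  classical
  by_cases h : ∃ i ∈ U, ∃ x ∈ slab U f, x ∈ T ∧ ∃ y ∈ slab U f, y ∈ T ∧ x.1 i ≠ y.1 i
  · obtain ⟨i, hi, x, hx, hxT, y, hy, hyT, hxy⟩ := h
    have key := sum_card_cutPairs_le (expGraph G H) {x.1 i, y.1 i}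
      (fun b => slab (U.erase i) (Function.update f i b)) (slab U f) T
      (fun b _ z hz => ((mem_slab_erase hi).1 hz).1)
      (fun b _ c _ hbc z hz => absurd
        (((mem_slab_erase hi).1 hz.1).2.symm.trans ((mem_slab_erase hi).1 hz.2).2) hbc)
    rw [Finset.sum_pair hxy] at key
    have h1 := ih i hi _ T ⟨x, (mem_slab_erase hi).2 ⟨hx, rfl⟩, hxT⟩
      (Set.not_subset.1 (hno i hi (x.1 i)))
    have h2 := ih i hi _ T ⟨y, (mem_slab_erase hi).2 ⟨hy, rfl⟩, hyT⟩
      (Set.not_subset.1 (hno i hi (y.1 i)))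
    -- The bound of one slice loses 1 with the coordinate `i`; the other slice contributes at least
    -- 1 and makes up for it.
    have h3 := Finset.card_erase_add_one hi
    omega
  · push Not at h
    obtain ⟨x, hx, hxT⟩ := hx
    obtain ⟨y, hy, hyT⟩ := hy
    have hslab : slab U f = slab U x.1 := by
      ext z
      exact forall₂_congr fun j hj => by rw [hx j hj]
    have hpos := hG.preconnected.minDegree_pos_of_nontrivial
    have key := card_cutPairs_of_subset_copy (G := G) (H := H) hpos (f := x.1) (U := U) (T := T)
      (fun z hz hzU => by
        rw [← hslab] at hzU
        funext j
        by_cases hj : j ∈ U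
        · exact h j hj z hzU hz x hx hxT
        · rw [hzU j hj, hx j hj])
    rw [← hslab] at key
    set A : Set W := {i | (x.1, i) ∈ T} with hA
    have hxA : x.2 ∈ A := hxT
    have hmul := Nat.le_mul_of_pos_right (A ∩ (U : Set W)).ncard hpos
    have hcard : A.ncard + U.card ≤ (A ∩ (U : Set W)).ncard + Fintype.card W := by
      rw [← Set.ncard_coe_finset U, ← Set.ncard_union_add_ncard_inter A U, add_comm,
        ← Nat.card_eq_fintype_card]
      exact Nat.add_le_add_left (Set.ncard_le_card _) _
    have hApos := (Set.ncard_pos (Set.toFinite A)).2 ⟨_, hxA⟩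
    have hU := U.card_le_univ
    constructor
    · by_cases hA1 : ∃ i, i ∉ A
      · obtain ⟨i, hi⟩ := hA1
        have := hH.one_le_card_cutPairs hxA hi
        omega
      · push Not at hA1
        have hAu : A = Set.univ := Set.eq_univ_of_forall hA1
        have hUne : U.card ≠ 0 := by
          intro h0
          rw [Finset.card_eq_zero] at h0
          refine hyT ?_
          have : y.1 = x.1 := funext fun j => by
            rw [hy j (by simp [h0]), hx j (by simp [h0])]
          have h2 : (x.1, y.2) ∈ T := hA1 y.2
          rwa [← this] at h2
        rw [hAu, Set.univ_inter, Set.ncard_coe_finset] at hmul key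
        omega
    -- For small `A` the copy of `H` gives `δ(H)` and `A ∩ U` the rest; for `|A| > δ(H)` the lines
    -- alone suffice.
    · by_cases hle : A.ncard ≤ H.minDegree
      · have := H.minDegree_le_card_cutPairs ⟨_, hxA⟩ hle
        omega
      · omega

/-- Used with all coordinates but one free, where it yields `δ(H)`. The weaker bound 1 is carried
along because the induction needs it; `|W|` stands on the right to avoid truncated subtraction. -/
theorem slab_bound (hG : G.Connected) (hH : H.Connected) (U : Finset W) :
    ∀ (f : W → V) (T : Set ((W → V) × W)),
      (∃ x ∈ slab U f, x ∈ T) → (∃ y ∈ slab U f, y ∉ T) →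
      1 ≤ ((expGraph G H).cutPairs (slab U f) T).card ∧
        H.minDegree + 1 + U.card ≤
          ((expGraph G H).cutPairs (slab U f) T).card + Fintype.card W := by
  induction U using Finset.strongInduction with
  | H U ih =>
    intro f T hx hy
    have ih' := fun i (hi : i ∈ U) => ih (U.erase i) (Finset.erase_ssubset hi)
    by_cases h1 : ∃ i ∈ U, ∃ b, slab (U.erase i) (Function.update f i b) ⊆ T
    · obtain ⟨i, hi, b, hb⟩ := h1
      by_cases h2 : ∃ c, slab (U.erase i) (Function.update f i c) ⊆ Tᶜ
      · obtain ⟨c, hc⟩ := h2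
        have h3 := card_pow_le_card_cutPairs (H := H) hG hi hb hc
        have h4 : 2 ^ (U.card - 1) ≤ Fintype.card V ^ (U.card - 1) :=
          Nat.pow_le_pow_left (Fintype.one_lt_card (α := V)) _
        have h5 := Nat.lt_two_pow_self (n := U.card - 1)
        have h6 := Finset.card_pos.2 ⟨i, hi⟩
        have := hH.nonempty
        have h7 := H.minDegree_lt_card
        omega
      -- No slice lies in `Tᶜ`: those parallel to the slice in `T` are excluded by `h2`, and all
      -- others meet it.
      · rw [← card_cutPairs_compl]
        refine slab_bound_of_no_slice_subset hG hH ih' hy (by simpa using hx) ?_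
        intro j hj c hc
        by_cases hji : j = i
        · exact h2 ⟨c, hji ▸ hc⟩
        · obtain ⟨k⟩ := hH.nonempty
          have hz : (Function.update (Function.update f i b) j c, k) ∈ slab U f := by
            intro l hl
            have h1 : l ≠ i := fun h => hl (h ▸ hi)
            have h2 : l ≠ j := fun h => hl (h ▸ hj)
            simp [h1, h2]
          exact hc ((mem_slab_erase hj).2 ⟨hz, by simp⟩)
            (hb ((mem_slab_erase hi).2 ⟨hz, by simp [Ne.symm hji]⟩))
    · push Not at h1
      exact slab_bound_of_no_slice_subset hG hH ih' hx hy h1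

end SlabBound

/-! ### The lower bound for boundaries and its equality case. -/

section CutBound

variable {V W : Type*} [Fintype V] [Fintype W] [DecidableEq W] [Nontrivial V] [Nontrivial W]
  {G : SimpleGraph V} {H : SimpleGraph W} [DecidableRel G.Adj] [DecidableRel H.Adj]

theorem cut_bound_of_subset_copy (hG : G.Connected) (hH : H.Connected)
    {T : Set ((W → V) × W)} {x : (W → V) × W} (hx : x ∈ T) (hT : ∀ y ∈ T, y.1 = x.1) :
    G.minDegree + H.minDegree ≤ ((expGraph G H).cutPairs Set.univ T).card ∧
      ((2 ≤ G.minDegree ∨ H ≠ ⊤) →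
        ((expGraph G H).cutPairs Set.univ T).card = G.minDegree + H.minDegree →
        T = {x}) := by
  classical
  have hpG := hG.preconnected.minDegree_pos_of_nontrivial
  have key := card_cutPairs_of_subset_copy (G := G) (H := H) hpG (f := x.1)
    (U := Finset.univ) (T := T) (fun z hz _ => hT z hz)
  rw [slab_univ, Finset.coe_univ, Set.inter_univ] at key
  set A : Set W := {i | (x.1, i) ∈ T} with hA
  have hxA : x.2 ∈ A := hx
  have hApos := (Set.ncard_pos (Set.toFinite A)).2 ⟨_, hxA⟩
  rcases le_or_gt A.ncard H.minDegree with hle | hlt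
  · have h1 := H.minDegree_le_card_cutPairs ⟨_, hxA⟩ hle
    rcases Nat.eq_or_lt_of_le hApos with hA1 | hA2
    · rw [← hA1] at key
      refine ⟨by omega, fun _ _ => ?_⟩
      obtain ⟨a, ha⟩ := Set.ncard_eq_one.1 hA1.symm
      refine Set.eq_singleton_iff_unique_mem.2 ⟨hx, fun y hy => ?_⟩
      have hyA : y.2 ∈ A := by
        change (x.1, y.2) ∈ T
        rwa [← hT y hy]
      rw [ha] at hxA hyA
      exact Prod.ext (hT y hy) (hyA.trans hxA.symm)
    · have h2 := Nat.mul_le_mul_right G.minDegree hA2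
      exact ⟨by omega, by omega⟩
  · have h2 := Nat.mul_le_mul_right G.minDegree hlt
    have h3 := Nat.le_mul_of_pos_right H.minDegree hpG
    rw [Nat.succ_mul] at h2
    refine ⟨by omega, fun hi he => ?_⟩
    have hpH := hH.preconnected.minDegree_pos_of_nontrivial
    -- Equality in `(δ(H) + 1) δ(G) ≥ δ(G) + δ(H)` forces `δ(G) = 1`; then the copy of `H` has no
    -- boundary edge, so `A` is all of `W` and `|W| = δ(H) + 1`.
    have h4 : G.minDegree = 1 := by
      by_contra hne
      have := Nat.mul_le_mul_left H.minDegree (show 2 ≤ G.minDegree by omega)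
      omega
    refine absurd ?_ (hi.resolve_left (by omega))
    apply eq_top_of_card_le_minDegree_add_one
    rw [h4, mul_one] at key
    have h5 : ∀ i, i ∈ A := by
      by_contra! h
      obtain ⟨i, hi⟩ := h
      have := hH.one_le_card_cutPairs hxA hi
      omega
    rw [Set.eq_univ_of_forall h5, Set.ncard_univ, Nat.card_eq_fintype_card] at key
    omega

/-- Pack the line through `z` with the slices at `z.2` that meet `T`; the line meets each slice in
one vertex. The trace of `T` on the line cannot have more points than there are such slices. -/
theorem cut_bound_of_mem_walker (hG : G.Connected) (hH : H.Connected)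
    {T : Set ((W → V) × W)} (hno : ∀ i b, ∃ x : (W → V) × W, x.1 i = b ∧ x ∉ T)
    {x y z : (W → V) × W} (hx : x ∈ T) (hy : y ∈ T) (hz : z ∈ T)
    (hxy : x.1 z.2 ≠ y.1 z.2) :
    G.minDegree + H.minDegree ≤ ((expGraph G H).cutPairs Set.univ T).card ∧
      ((2 ≤ H.minDegree ∨ G ≠ ⊤) →
        ((expGraph G H).cutPairs Set.univ T).card ≠ G.minDegree + H.minDegree) := by
  classical
  have hpH := hH.preconnected.minDegree_pos_of_nontrivial
  have hpG := hG.preconnected.minDegree_pos_of_nontrivial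
  obtain ⟨f, w⟩ := z
  dsimp only at hxy
  set M : Set V := {b | ∃ p ∈ T, p.1 w = b} with hM
  let P : Option V → Set ((W → V) × W) := fun o =>
    o.elim (Set.range (baseLine f w))
      (fun b => slab (Finset.univ.erase w) (Function.update f w b))
  have key := sum_card_cutPairs_le (expGraph G H) (Finset.insertNone M.toFinset) P
    Set.univ T (fun _ _ => Set.subset_univ _) ?_
  · rw [Finset.sum_insertNone] at key
    have hline := card_cutPairs_comp_le (K' := G) (K := expGraph G H) (baseLine f w)
      (baseLine_injective f w) (expGraph_adj_baseLine f w) (fun t => Set.mem_range_self t) T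
    have hslice : M.ncard * H.minDegree ≤ ∑ b ∈ M.toFinset,
        ((expGraph G H).cutPairs (P (some b)) T).card := by
      rw [Set.ncard_eq_toFinset_card', ← smul_eq_mul]
      refine Finset.card_nsmul_le_sum _ _ _ fun b hb => ?_
      obtain ⟨p, hp, rfl⟩ := Set.mem_toFinset.1 hb
      obtain ⟨q, hq, hqT⟩ := hno w (p.1 w)
      have := (slab_bound (G := G) (H := H) hG hH (Finset.univ.erase w)
        (Function.update f w (p.1 w)) T
        ⟨p, mem_slab_univ_erase.2 (by simp), hp⟩
        ⟨q, mem_slab_univ_erase.2 (by simp [hq]), hqT⟩).2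
      rw [Finset.card_erase_of_mem (Finset.mem_univ w), Finset.card_univ] at this
      have := Fintype.card_pos (α := W)
      change _ ≤ (((expGraph G H).cutPairs (slab _ _) T)).card
      omega
    set B : Set V := baseLine f w ⁻¹' T with hB
    have hfB : f w ∈ B := by simpa [hB, baseLine] using hz
    have hBM : B ⊆ M := fun t ht => ⟨baseLine f w t, ht, by simp [baseLine]⟩
    have hBM' := Set.ncard_le_ncard hBM (Set.toFinite _)
    have hM2 : 2 ≤ M.ncard := (Set.one_lt_ncard (Set.toFinite M)).2
      ⟨x.1 w, ⟨x, hx, rfl⟩, y.1 w, ⟨y, hy, rfl⟩, hxy⟩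
    change (Finset.card ((expGraph G H).cutPairs (Set.range (baseLine f w)) T)) + _ ≤ _ at key
    rcases le_or_gt B.ncard G.minDegree with hle | hlt
    · have h1 := G.minDegree_le_card_cutPairs ⟨_, hfB⟩ hle
      have h2 := Nat.mul_le_mul_right H.minDegree hM2
      exact ⟨by omega, by omega⟩
    · have h2 := Nat.mul_le_mul_right H.minDegree (hlt.trans_le hBM')
      have h3 := Nat.le_mul_of_pos_right G.minDegree hpH
      rw [Nat.succ_mul] at h2
      refine ⟨by omega, fun hi he => ?_⟩
      have h4 : H.minDegree = 1 := by
        by_contra hne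
        have := Nat.mul_le_mul_left G.minDegree (show 2 ≤ H.minDegree by omega)
        omega
      refine absurd ?_ (hi.resolve_left (by omega))
      apply eq_top_of_card_le_minDegree_add_one
      have h5 : ∀ i, i ∈ B := by
        by_contra! h
        obtain ⟨i, hi⟩ := h
        have := hG.one_le_card_cutPairs hfB hi
        omega
      rw [Set.eq_univ_of_forall h5, Set.ncard_univ, Nat.card_eq_fintype_card] at hBM'
      rw [h4, mul_one] at hslice
      omega
  · have hsl : ∀ b t, baseLine f w t ∈ P (some b) → t = b := fun b t h => by
      simpa [baseLine] using mem_slab_univ_erase.1 h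
    rintro (_ | b) - (_ | c) - hne
    · exact absurd rfl hne
    · rintro _ ⟨⟨t, rfl⟩, h⟩ _ ⟨⟨s, rfl⟩, h'⟩
      rw [hsl _ _ h, hsl _ _ h']
    · rintro _ ⟨h, ⟨t, rfl⟩⟩ _ ⟨h', ⟨s, rfl⟩⟩
      rw [hsl _ _ h, hsl _ _ h']
    · rintro p ⟨hb, hc⟩
      have hb := mem_slab_univ_erase.1 hb
      have hc := mem_slab_univ_erase.1 hc
      simp only [Function.update_self] at hb hc
      exact absurd (congrArg some (hb.symm.trans hc)) hne

theorem cut_bound_of_no_slice_subset (hG : G.Connected) (hH : H.Connected) (n : ℕ) :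
    ∀ T : Set ((W → V) × W), T.ncard = n → T.Nonempty →
      (∀ i b, ∃ x : (W → V) × W, x.1 i = b ∧ x ∉ T) →
      G.minDegree + H.minDegree ≤ ((expGraph G H).cutPairs Set.univ T).card ∧
        ((2 ≤ G.minDegree ∨ H ≠ ⊤) → (2 ≤ H.minDegree ∨ G ≠ ⊤) →
          ((expGraph G H).cutPairs Set.univ T).card = G.minDegree + H.minDegree →
          ∃ x, T = {x}) := by
  classical
  induction n using Nat.strong_induction_on with
  | _ n ih =>
    rintro T rfl ⟨x, hx⟩ hno
    by_cases h1 : ∀ y ∈ T, y.1 = x.1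
    · have := cut_bound_of_subset_copy hG hH hx h1
      exact ⟨this.1, fun hi _ he => ⟨x, this.2 hi he⟩⟩
    push Not at h1
    obtain ⟨y, hy, hyx⟩ := h1
    obtain ⟨w, hw⟩ := Function.ne_iff.1 hyx
    by_cases h2 : ∃ z ∈ T, z.2 = w
    · obtain ⟨z, hz, rfl⟩ := h2
      have := cut_bound_of_mem_walker hG hH hno hy hx hz hw
      exact ⟨this.1, fun _ hi he => absurd he (this.2 hi)⟩
    · push Not at h2
      set A : Set ((W → V) × W) := {p | p ∈ T ∧ p.1 w = x.1 w} with hA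
      set B : Set ((W → V) × W) := {p | p ∈ T ∧ p.1 w ≠ x.1 w} with hB
      have hAT : A ⊂ T := ⟨fun p hp => hp.1, fun h => hw (h hy).2⟩
      have hBT : B ⊂ T := ⟨fun p hp => hp.1, fun h => (h hx).2 rfl⟩
      have hA1 := (ih _ (Set.ncard_lt_ncard hAT (Set.toFinite _)) A rfl ⟨x, hx, rfl⟩
        fun i b => (hno i b).imp fun p hp => ⟨hp.1, fun h => hp.2 h.1⟩).1
      have hB1 := (ih _ (Set.ncard_lt_ncard hBT (Set.toFinite _)) B rfl ⟨y, hy, hw⟩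
        fun i b => (hno i b).imp fun p hp => ⟨hp.1, fun h => hp.2 h.1⟩).1
      -- No edge at `T` changes coordinate `w`, so no edge joins `A` to `B` and their boundaries
      -- both lie in that of `T`; twice the bound is strictly larger.
      have hadj : ∀ p q, p ∈ T → (expGraph G H).Adj p q → p.1 w = q.1 w := by
        rintro p q hp (⟨-, -, h⟩ | ⟨-, h⟩)
        · exact h w (h2 p hp).symm
        · exact h w
      have hdisj : Disjoint ((expGraph G H).cutPairs Set.univ A)
          ((expGraph G H).cutPairs Set.univ B) := by
        refine Finset.disjoint_left.2 fun e he he' => ?_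
        exact (mem_cutPairs.1 he').2.1.2 (mem_cutPairs.1 he).2.1.2
      have hsub : (expGraph G H).cutPairs Set.univ A ∪ (expGraph G H).cutPairs Set.univ B ⊆
          (expGraph G H).cutPairs Set.univ T := by
        refine Finset.union_subset (fun e he => ?_) (fun e he => ?_) <;>
        · rw [mem_cutPairs] at he ⊢
          obtain ⟨h0, h1, h3, h4⟩ := he
          refine ⟨h0, h1.1, fun h => h3 ⟨h, ?_⟩, h4⟩
          rw [← hadj _ _ h1.1 h4]
          exact h1.2
      have hle := Finset.card_le_card hsub
      rw [Finset.card_union_of_disjoint hdisj] at hle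
      have hpG := hG.preconnected.minDegree_pos_of_nontrivial
      exact ⟨by omega, by omega⟩

theorem add_sub_le_pow {n m : ℕ} (hn : 2 ≤ n) (hm : 2 ≤ m) :
    n + m ≤ n ^ (m - 1) + 2 ∧ (3 ≤ m → n + m < n ^ (m - 1) + 2) := by
  have h : ∀ k, n + (k + 3) < n ^ (k + 2) + 2 := by
    intro k
    induction k with
    | zero => simp only [zero_add]; nlinarith
    | succ k ih => rw [pow_succ]; nlinarith
  rcases Nat.eq_or_lt_of_le hm with rfl | hm
  · simp
  · obtain ⟨k, rfl⟩ := Nat.exists_eq_add_of_le' (show 3 ≤ m from hm)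
    exact ⟨(h k).le, fun _ => h k⟩

theorem cut_bound (hG : G.Connected) (hH : H.Connected) {T : Set ((W → V) × W)}
    (hT : T.Nonempty) (hTc : Tᶜ.Nonempty) :
    G.minDegree + H.minDegree ≤ ((expGraph G H).cutPairs Set.univ T).card ∧
      ((2 ≤ G.minDegree ∨ H ≠ ⊤) → (2 ≤ H.minDegree ∨ G ≠ ⊤) →
        ((expGraph G H).cutPairs Set.univ T).card = G.minDegree + H.minDegree →
        ∃ x, T = {x} ∨ Tᶜ = {x}) := by
  classical
  by_cases h1 : ∃ i b, ∀ x : (W → V) × W, x.1 i = b → x ∈ T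
  · obtain ⟨i, b, hb⟩ := h1
    by_cases h2 : ∃ c, ∀ x : (W → V) × W, x.1 i = c → x ∈ Tᶜ
    · obtain ⟨c, hc⟩ := h2
      have h3 := card_pow_le_card_cutPairs (H := H) hG (Finset.mem_univ i) (f := fun _ => b)
        (b := b) (c := c) (T := T) (fun x hx => hb x (by simpa using mem_slab_univ_erase.1 hx))
        (fun x hx => hc x (by simpa using mem_slab_univ_erase.1 hx))
      rw [slab_univ, Finset.card_univ] at h3
      have hm := Fintype.one_lt_card (α := W)
      have h4 := add_sub_le_pow (Fintype.one_lt_card (α := V)) hm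
      have h5 := H.minDegree_lt_card
      have h6 := G.minDegree_lt_card
      refine ⟨by omega, fun _ hi he => ?_⟩
      have hpH := hH.preconnected.minDegree_pos_of_nontrivial
      -- Equality is possible only for `|W| = 2`; then `δ(H) = 1` and `|V| = δ(G) + 1`, which (ii)
      -- forbids.
      rcases Nat.eq_or_lt_of_le hm with hm | hm
      · refine absurd (G.eq_top_of_card_le_minDegree_add_one ?_) (hi.resolve_left (by omega))
        omega
      · have := h4.2 hm
        omega
    · push Not at h2
      have := cut_bound_of_no_slice_subset (G := G) (H := H) hG hH _ Tᶜ rfl hTc ?_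
      · rw [card_cutPairs_compl] at this
        exact ⟨this.1, fun h h' he => (this.2 h h' he).imp fun _ => Or.inr⟩
      · intro j c
        by_cases hji : j = i
        · exact hji ▸ h2 c
        · obtain ⟨k⟩ := hH.nonempty
          exact ⟨(Function.update (fun _ => b) j c, k), by simp,
            fun h => h (hb _ (by simp [Ne.symm hji]))⟩
  · push Not at h1
    have := cut_bound_of_no_slice_subset (G := G) (H := H) hG hH _ T rfl hT h1
    exact ⟨this.1, fun h h' he => (this.2 h h' he).imp fun _ => Or.inl⟩

end CutBound

/-! ### Edge-cuts and edge boundaries. -/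

section EdgeBoundary

variable {α : Type*} [Fintype α]

/-- The edges of `K` with exactly one end in `T`. -/
def edgeBoundary (K : SimpleGraph α) (T : Set α) : Set (Sym2 α) :=
  (fun p : α × α => s(p.1, p.2)) '' (K.cutPairs Set.univ T : Set (α × α))

theorem mem_edgeBoundary {K : SimpleGraph α} {T : Set α} {e : Sym2 α} :
    e ∈ K.edgeBoundary T ↔ ∃ x y, x ∈ T ∧ y ∉ T ∧ K.Adj x y ∧ s(x, y) = e := by
  simp [edgeBoundary, mem_cutPairs, and_assoc]

theorem ncard_edgeBoundary (K : SimpleGraph α) (T : Set α) :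
    (K.edgeBoundary T).ncard = (K.cutPairs Set.univ T).card := by
  rw [edgeBoundary, Set.InjOn.ncard_image, Set.ncard_coe_finset]
  rintro ⟨x, y⟩ h ⟨x', y'⟩ h' heq
  simp only [Finset.mem_coe, mem_cutPairs] at h h'
  rcases Sym2.eq_iff.1 heq with ⟨rfl, rfl⟩ | ⟨rfl, rfl⟩
  · rfl
  · exact absurd h.2.1 h'.2.2.1

theorem isEdgeCut_edgeBoundary (K : SimpleGraph α) {T : Set α} (hT : T.Nonempty)
    (hTc : Tᶜ.Nonempty) : K.IsEdgeCut (K.edgeBoundary T) := by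
  obtain ⟨x, hx⟩ := hT
  obtain ⟨y, hy⟩ := hTc
  refine ⟨fun e he => ?_, fun hconn => ?_⟩
  · obtain ⟨p, q, -, -, h, rfl⟩ := mem_edgeBoundary.1 he
    exact h
  · obtain ⟨p⟩ := hconn.preconnected x y
    obtain ⟨d, -, h1, h2⟩ := p.exists_boundary_dart T hx hy
    have h3 := deleteEdges_adj.1 d.adj
    exact h3.2 (mem_edgeBoundary.2 ⟨_, _, h1, h2, h3.1, rfl⟩)

/-- Take for `T` a connected component of what is left after the deletion. -/
theorem IsEdgeCut.exists_edgeBoundary_subset [Nonempty α] {K : SimpleGraph α}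
    {F : Set (Sym2 α)} (hF : K.IsEdgeCut F) :
    ∃ T : Set α, T.Nonempty ∧ Tᶜ.Nonempty ∧ K.edgeBoundary T ⊆ F := by
  have h : ¬ (K.deleteEdges F).Preconnected := fun h => hF.2 ⟨h⟩
  simp only [Preconnected, not_forall] at h
  obtain ⟨x, y, hxy⟩ := h
  refine ⟨{z | (K.deleteEdges F).Reachable x z}, ⟨x, Reachable.refl x⟩, ⟨y, hxy⟩, ?_⟩
  intro e he
  obtain ⟨p, q, hp, hq, hadj, rfl⟩ := mem_edgeBoundary.1 he
  by_contra hne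
  exact hq (Reachable.trans hp (deleteEdges_adj.2 ⟨hadj, hne⟩ : (K.deleteEdges F).Adj p q).reachable)

theorem edgeBoundary_singleton (K : SimpleGraph α) (x : α) :
    K.edgeBoundary {x} = K.incidenceSet x := by
  ext e
  rw [mem_edgeBoundary]
  constructor
  · rintro ⟨p, q, rfl, -, h, rfl⟩
    exact ⟨h, Sym2.mem_mk_left _ _⟩
  · rintro ⟨h, hx⟩
    obtain ⟨y, rfl⟩ := Sym2.mem_iff_exists.1 hx
    exact ⟨x, y, rfl, (K.ne_of_adj h).symm, h, rfl⟩

theorem edgeBoundary_compl (K : SimpleGraph α) (T : Set α) :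
    K.edgeBoundary Tᶜ = K.edgeBoundary T := by
  ext e
  simp only [mem_edgeBoundary]
  constructor <;>
  · rintro ⟨p, q, hp, hq, h, rfl⟩
    exact ⟨q, p, by simpa using hq, by simpa using hp, h.symm, Sym2.eq_swap⟩

theorem ncard_incidenceSet (K : SimpleGraph α) [DecidableRel K.Adj] (x : α) :
    (K.incidenceSet x).ncard = K.degree x := by
  classical
  rw [← card_incidenceFinset_eq_degree, ← Set.ncard_coe_finset, coe_incidenceFinset]

end EdgeBoundary

/-! ### The two exceptional cuts as boundaries of a copy of `H` and of a line. -/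

section CutBoundary

variable {V W : Type*} [Fintype V] [Fintype W] [DecidableEq W]
  {G : SimpleGraph V} {H : SimpleGraph W}

theorem baseCut_eq_edgeBoundary [DecidableRel G.Adj] {a b : V} (ha : G.degree a = 1) (hab : G.Adj a b) :
    baseCut W a b = (expGraph G H).edgeBoundary {x | x.1 = fun _ => a} := by
  have huniq : ∀ {y z}, G.Adj a y → G.Adj a z → y = z :=
    (G.degree_eq_one_iff_existsUnique_adj.1 ha).unique
  ext e
  rw [mem_edgeBoundary]
  constructor
  · rintro ⟨w, rfl⟩
    refine ⟨_, _, rfl, fun h => ?_, ?_, rfl⟩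
    · have := congrFun (show Function.update (fun _ => a) w b = fun _ => a from h) w
      exact hab.ne (by simpa using this.symm)
    · have h := expGraph_adj_baseLine (H := H) (fun _ => a) w _ _ hab
      simpa [baseLine] using h
  · rintro ⟨⟨f, w⟩, ⟨g, z⟩, rfl, hg, ⟨rfl, h1, h2⟩ | ⟨h1, h2⟩, rfl⟩
    · have hgb : g w = b := huniq h1 hab
      refine ⟨w, ?_⟩
      have : Function.update (fun _ => a) w b = g :=
        Function.update_eq_iff.2 ⟨hgb.symm, h2⟩
      simp [this]
    · exact absurd (funext fun j => (h2 j).symm) hg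

theorem exponentCut_eq_edgeBoundary [DecidableRel H.Adj] {c d : W} (hc : H.degree c = 1) (hcd : H.Adj c d)
    (f : W → V) : exponentCut f c d =
      (expGraph G H).edgeBoundary {x | x.2 = c ∧ ∀ j, j ≠ c → x.1 j = f j} := by
  have huniq : ∀ {y z}, H.Adj c y → H.Adj c z → y = z :=
    (H.degree_eq_one_iff_existsUnique_adj.1 hc).unique
  ext e
  rw [mem_edgeBoundary]
  constructor
  · rintro ⟨t, rfl⟩
    exact ⟨_, _, ⟨rfl, fun j hj => by simp [hj]⟩, fun h => hcd.ne h.1.symm,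
      expGraph_adj_prodMk _ _ _ hcd, rfl⟩
  · rintro ⟨⟨g, c⟩, ⟨g', z⟩, ⟨rfl, hg⟩, hg', ⟨rfl, h1, h2⟩ | ⟨h1, h2⟩, rfl⟩
    · exact absurd ⟨rfl, fun j hj => (h2 j hj).symm.trans (hg j hj)⟩ hg'
    · obtain rfl : z = d := huniq h1 hcd
      obtain rfl : g = g' := funext h2
      refine ⟨g c, ?_⟩
      have : Function.update f c (g c) = g :=
        Function.update_eq_iff.2 ⟨rfl, fun j hj => (hg j hj).symm⟩
      simp [this]

end CutBoundary

/-! ### Minimality of the exceptional cuts. -/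

section ExpGraphCut

variable {V W : Type*} [Fintype V] [Fintype W] [DecidableEq W] [Nontrivial V] [Nontrivial W]
  {G : SimpleGraph V} {H : SimpleGraph W} [DecidableRel G.Adj] [DecidableRel H.Adj]

theorem IsEdgeCut.add_minDegree_le_ncard (hG : G.Connected) (hH : H.Connected)
    {F : Set (Sym2 ((W → V) × W))} (hF : (expGraph G H).IsEdgeCut F) :
    G.minDegree + H.minDegree ≤ F.ncard := by
  obtain ⟨T, hT, hTc, hTF⟩ := hF.exists_edgeBoundary_subset
  refine (cut_bound hG hH hT hTc).1.trans ?_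
  rw [← ncard_edgeBoundary]
  exact Set.ncard_le_ncard hTF (Set.toFinite _)

theorem isMinEdgeCut_baseCut (hG : G.Connected) (hH : H.Connected) (hK : H = ⊤) {a b : V}
    (ha : G.degree a = 1) (hab : G.Adj a b) :
    (expGraph G H).IsMinEdgeCut (baseCut W a b) := by
  obtain ⟨w⟩ := hH.nonempty
  refine ⟨?_, fun F' hF' => ?_⟩
  · rw [baseCut_eq_edgeBoundary (H := H) ha hab]
    exact isEdgeCut_edgeBoundary _ ⟨(fun _ => a, w), rfl⟩
      ⟨(fun _ => b, w), fun h => hab.ne (congrFun h w).symm⟩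
  · refine le_trans ?_ (hF'.add_minDegree_le_ncard hG hH)
    have h1 : (baseCut W a b).ncard ≤ Fintype.card W := by
      rw [baseCut, ← Set.image_univ, ← Nat.card_eq_fintype_card, ← Set.ncard_univ]
      exact Set.ncard_image_le
    have h2 := card_le_minDegree_add_one H hK
    have h3 := hG.preconnected.minDegree_pos_of_nontrivial
    omega

theorem isMinEdgeCut_exponentCut (hG : G.Connected) (hH : H.Connected) (hK : G = ⊤) {c d : W}
    (hc : H.degree c = 1) (hcd : H.Adj c d) (f : W → V) :
    (expGraph G H).IsMinEdgeCut (exponentCut f c d) := by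
  refine ⟨?_, fun F' hF' => ?_⟩
  · rw [exponentCut_eq_edgeBoundary (G := G) hc hcd f]
    exact isEdgeCut_edgeBoundary _ ⟨(f, c), rfl, fun _ _ => rfl⟩
      ⟨(f, d), fun h => hcd.ne h.1.symm⟩
  · refine le_trans ?_ (hF'.add_minDegree_le_ncard hG hH)
    have h1 : (exponentCut f c d).ncard ≤ Fintype.card V := by
      rw [exponentCut, ← Set.image_univ, ← Nat.card_eq_fintype_card, ← Set.ncard_univ]
      exact Set.ncard_image_le
    have h2 := card_le_minDegree_add_one G hK
    have h3 := hH.preconnected.minDegree_pos_of_nontrivial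
    omega

end ExpGraphCut

/-! ### Degrees and super edge-connectivity of the exponential graph. -/

section ExpGraph

variable {V W : Type*} [Fintype V] [Fintype W] [DecidableEq V] [DecidableEq W]
  {G : SimpleGraph V} {H : SimpleGraph W} [DecidableRel G.Adj] [DecidableRel H.Adj]

theorem degree_expGraph (x : (W → V) × W) :
    (expGraph G H).degree x = G.degree (x.1 x.2) + H.degree x.2 := by
  obtain ⟨f, w⟩ := x
  have h : (expGraph G H).neighborFinset (f, w) =
      (G.neighborFinset (f w)).image (baseLine f w) ∪
        (H.neighborFinset w).image (Prod.mk f) := by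
    ext ⟨g, z⟩
    simp only [mem_neighborFinset, Finset.mem_union, Finset.mem_image, baseLine, Prod.mk.injEq]
    constructor
    · rintro (⟨rfl, h1, h2⟩ | ⟨h1, h2⟩)
      · refine Or.inl ⟨g w, h1, ?_, rfl⟩
        rw [Function.update_eq_iff]
        exact ⟨rfl, h2⟩
      · exact Or.inr ⟨z, h1, funext h2, rfl⟩
    · rintro (⟨t, ht, rfl, rfl⟩ | ⟨z, hz, rfl, rfl⟩)
      · have h := expGraph_adj_baseLine (H := H) f w _ _ ht
        simpa [baseLine] using h
      · exact expGraph_adj_prodMk f _ _ hz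
  rw [← card_neighborFinset_eq_degree, h, Finset.card_union_of_disjoint,
    Finset.card_image_of_injective _ (baseLine_injective f w),
    Finset.card_image_of_injective _ (Prod.mk_right_injective f), card_neighborFinset_eq_degree,
    card_neighborFinset_eq_degree]
  rw [Finset.disjoint_left]
  simp only [Finset.mem_image, mem_neighborFinset, not_exists, not_and]
  rintro _ ⟨t, -, rfl⟩ z hz h
  exact hz.ne (Prod.ext_iff.1 h).2.symm

theorem minDegree_expGraph [Nonempty V] [Nonempty W] :
    (expGraph G H).minDegree = G.minDegree + H.minDegree := by
  apply le_antisymm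
  · obtain ⟨a, ha⟩ := G.exists_minimal_degree_vertex
    obtain ⟨w, hw⟩ := H.exists_minimal_degree_vertex
    rw [ha, hw]
    exact ((expGraph G H).minDegree_le_degree (fun _ => a, w)).trans_eq (degree_expGraph _)
  · refine le_minDegree_of_forall_le_degree _ _ fun x => ?_
    rw [degree_expGraph]
    exact add_le_add (G.minDegree_le_degree _) (H.minDegree_le_degree _)

/-- An isolated vertex would lie on every edge of the cut, but these edges sit at different
positions. -/
theorem not_isolatesVertex_baseCut [Nontrivial W] (a b : V) :
    ¬ (expGraph G H).IsolatesVertex (baseCut W a b) := by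
  rintro ⟨x, -, hx⟩
  have key : ∀ w : W, x.2 = w := fun w => by
    have h : s((fun _ => a, w), (Function.update (fun _ => a) w b, w)) ∈
        (expGraph G H).incidenceSet x := hx ▸ Set.mem_range_self w
    rcases Sym2.mem_iff.1 h.2 with h | h <;> rw [h]
  obtain ⟨w, hw⟩ := exists_ne x.2
  exact hw (key w).symm

theorem not_isolatesVertex_exponentCut [Nontrivial V] (f : W → V) (c d : W) :
    ¬ (expGraph G H).IsolatesVertex (exponentCut f c d) := by
  rintro ⟨x, -, hx⟩
  have key : ∀ t : V, x.1 c = t := fun t => by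
    have h : s((Function.update f c t, c), (Function.update f c t, d)) ∈
        (expGraph G H).incidenceSet x := hx ▸ Set.mem_range_self t
    rcases Sym2.mem_iff.1 h.2 with h | h <;> simp [h]
  obtain ⟨t, ht⟩ := exists_ne (x.1 c)
  exact ht (key t).symm

variable [Nontrivial V] [Nontrivial W]

theorem isSuperEdgeConnected_expGraph (hG : G.Connected) (hH : H.Connected)
    (h1 : 2 ≤ G.minDegree ∨ H ≠ ⊤) (h2 : 2 ≤ H.minDegree ∨ G ≠ ⊤) :
    (expGraph G H).IsSuperEdgeConnected := by
  refine ⟨?_, fun F hF => ?_⟩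
  -- In a disconnected graph the empty set would be an edge-cut, below the positive lower bound.
  · by_contra hcon
    have hcut : (expGraph G H).IsEdgeCut ∅ := ⟨Set.empty_subset _, by simpa using hcon⟩
    have := hcut.add_minDegree_le_ncard hG hH
    rw [Set.ncard_empty] at this
    have := hG.preconnected.minDegree_pos_of_nontrivial
    omega
  · obtain ⟨T, hT, hTc, hTF⟩ := hF.1.exists_edgeBoundary_subset
    obtain ⟨v, hv⟩ := (expGraph G H).exists_minimal_degree_vertex
    obtain ⟨u, hu⟩ := exists_ne v
    have hle := hF.2 _ ((expGraph G H).isEdgeCut_edgeBoundary (T := {v}) ⟨v, rfl⟩ ⟨u, hu⟩)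
    rw [edgeBoundary_singleton, ncard_incidenceSet, ← hv, minDegree_expGraph] at hle
    have hb := cut_bound hG hH hT hTc
    rw [← ncard_edgeBoundary] at hb
    obtain rfl : (expGraph G H).edgeBoundary T = F :=
      Set.eq_of_subset_of_ncard_le hTF (hle.trans hb.1) (Set.toFinite _)
    have hx : ∃ x, (expGraph G H).edgeBoundary T = (expGraph G H).incidenceSet x := by
      obtain ⟨x, hx | hx⟩ := hb.2 h1 h2 (le_antisymm hle hb.1)
      · exact ⟨x, by rw [hx, edgeBoundary_singleton]⟩
      · exact ⟨x, by rw [← edgeBoundary_compl, hx, edgeBoundary_singleton]⟩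
    obtain ⟨x, hx⟩ := hx
    refine ⟨x, ?_, hx⟩
    rw [minDegree_expGraph, ← ncard_incidenceSet, ← hx]
    exact le_antisymm hle hb.1

end ExpGraph

end SimpleGraph

theorem mainTheorem2 {V : Type*} {W : Type*} [Fintype V] [Fintype W] [DecidableEq V]
    [DecidableEq W] [Nontrivial V] [Nontrivial W]
    (G : SimpleGraph V) (H : SimpleGraph W) [DecidableRel G.Adj] [DecidableRel H.Adj]
    (hG : G.Connected) (hH : H.Connected) :
    ((SimpleGraph.expGraph G H).IsSuperEdgeConnected ↔
      (2 ≤ G.minDegree ∨ H ≠ ⊤) ∧ (2 ≤ H.minDegree ∨ G ≠ ⊤)) ∧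
    (H = ⊤ → ∀ a b : V, G.degree a = 1 → G.Adj a b →
      (SimpleGraph.expGraph G H).IsMinEdgeCut (SimpleGraph.baseCut W a b) ∧
        ¬ (SimpleGraph.expGraph G H).IsolatesVertex (SimpleGraph.baseCut W a b)) ∧
    (G = ⊤ → ∀ c d : W, H.degree c = 1 → H.Adj c d → ∀ f : W → V,
      (SimpleGraph.expGraph G H).IsMinEdgeCut (SimpleGraph.exponentCut f c d) ∧
        ¬ (SimpleGraph.expGraph G H).IsolatesVertex (SimpleGraph.exponentCut f c d)) := by
  refine ⟨⟨fun hs => ⟨?_, ?_⟩,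
    fun h => SimpleGraph.isSuperEdgeConnected_expGraph hG hH h.1 h.2⟩,
    fun hK a b ha hab => ⟨SimpleGraph.isMinEdgeCut_baseCut hG hH hK ha hab,
      SimpleGraph.not_isolatesVertex_baseCut a b⟩,
    fun hK c d hc hcd f => ⟨SimpleGraph.isMinEdgeCut_exponentCut hG hH hK hc hcd f,
      SimpleGraph.not_isolatesVertex_exponentCut f c d⟩⟩
  · by_contra! h
    obtain ⟨a, b, ha, hab⟩ := SimpleGraph.exists_adj_of_minDegree_lt_two hG h.1.not_ge
    exact SimpleGraph.not_isolatesVertex_baseCut a b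
      (hs.2 _ (SimpleGraph.isMinEdgeCut_baseCut hG hH h.2 ha hab))
  · by_contra! h
    obtain ⟨c, d, hc, hcd⟩ := SimpleGraph.exists_adj_of_minDegree_lt_two hH h.1.not_ge
    obtain ⟨t⟩ := hG.nonempty
    exact SimpleGraph.not_isolatesVertex_exponentCut (fun _ => t) c d
      (hs.2 _ (SimpleGraph.isMinEdgeCut_exponentCut hG hH h.2 hc hcd _))
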